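/- Let $\varphi$ be a homeomorphism of a nonempty totally disconnected compact metric space $X$, and let $M_\varphi$ be the set of $\varphi$-invariant Borel probability measures on $X$. For clopen sets $A, B \subset X$ write $A \ge B$ if either $\mu(A) > \mu(B)$ for all $\mu \in M_\varphi$, or $\mu(A) = \mu(B)$ for all $\mu \in M_\varphi$; call $A$ and $B$ comparable if $A \ge B$ or $B \ge A$. Let $C(X,\mathbb{Z})$ be the group of continuous integer-valued functions on $X$, let $Z_\varphi = \{f \in C(X,\mathbb{Z}) : \int_X f\,d\mu = 0 \text{ for all } \mu \in M_\varphi\}$, let $G_\varphi = C(X,\mathbb{Z})/Z_\varphi$, and let $G_\varphi^+ = \{[f] \in G_\varphi : f \ge 0\}$, where $[f]$ denotes the class of $f \in C(X,\mathbb{Z})$; order $G_\varphi$ by $a \le b$ if and only if $b - a \in G_\varphi^+$. Then the following are equivalent: (i) $\varphi$ is uniquely ergodic, that is, $M_\varphi$ has exactly one element; (ii) any two clopen subsets of $X$ are comparable; (iii) the ordered group $(G_\varphi, G_\varphi^+)$ is totally ordered, that is, for all $a, b \in G_\varphi$, $a \le b$ or $b \le a$. -/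

import Mathlib

open MeasureTheory

namespace ClopenDynamics

variable {X : Type*} [MetricSpace X] [CompactSpace X] [MeasurableSpace X] [BorelSpace X]

/-- The set `M_φ` of all `φ`-invariant Borel probability measures on `X`. -/
def invariantMeasures (φ : X ≃ₜ X) : Set (ProbabilityMeasure X) :=
  {μ | MeasurePreserving φ (μ : Measure X) (μ : Measure X)}

/-- `φ` is uniquely ergodic: it has exactly one invariant Borel probability measure. -/
def UniquelyErgodic (φ : X ≃ₜ X) : Prop :=
  ∃! μ : ProbabilityMeasure X, μ ∈ invariantMeasures φ

/-- The relation `A ≥ B`: either `μ(A) > μ(B)` for all `μ ∈ M_φ`,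
or `μ(A) = μ(B)` for all `μ ∈ M_φ`. -/
def Dominates (φ : X ≃ₜ X) (A B : Set X) : Prop :=
  (∀ μ ∈ invariantMeasures φ, (μ : Measure X) A > (μ : Measure X) B) ∨
    (∀ μ ∈ invariantMeasures φ, (μ : Measure X) A = (μ : Measure X) B)

/-- `A` and `B` are comparable: `A ≥ B` or `B ≥ A`. -/
def Comparable (φ : X ≃ₜ X) (A B : Set X) : Prop :=
  Dominates φ A B ∨ Dominates φ B A

theorem integrable_intCast (f : C(X, ℤ)) (μ : ProbabilityMeasure X) :
    Integrable (fun x => (f x : ℝ)) (μ : Measure X) := by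
  have hc : Continuous (fun x => (f x : ℝ)) :=
    (continuous_of_discreteTopology (f := fun n : ℤ => (n : ℝ))).comp f.continuous
  exact hc.integrable_of_hasCompactSupport (HasCompactSupport.of_compactSpace _)

/-- The subgroup `Z_φ` of those `f ∈ C(X, ℤ)` with `∫ f dμ = 0` for all `μ ∈ M_φ`. -/
def infinitesimals (φ : X ≃ₜ X) : AddSubgroup C(X, ℤ) where
  carrier := {f | ∀ μ ∈ invariantMeasures φ, ∫ x, (f x : ℝ) ∂(μ : Measure X) = 0}
  zero_mem' := by
    intro μ _
    simp
  add_mem' := by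
    intro f g hf hg μ hμ
    have h := integral_add (integrable_intCast f μ) (integrable_intCast g μ)
    rw [hf μ hμ, hg μ hμ, add_zero] at h
    simpa using h
  neg_mem' := by
    intro f hf μ hμ
    have h := integral_neg (μ := (μ : Measure X)) (fun x => (f x : ℝ))
    rw [hf μ hμ, neg_zero] at h
    simpa using h

/-- The group `G_φ = C(X, ℤ) / Z_φ`. -/
def G (φ : X ≃ₜ X) : Type _ := C(X, ℤ) ⧸ infinitesimals φ

instance (φ : X ≃ₜ X) : AddCommGroup (G φ) :=
  inferInstanceAs (AddCommGroup (C(X, ℤ) ⧸ infinitesimals φ))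

/-- The quotient homomorphism `f ↦ [f]` from `C(X, ℤ)` onto `G_φ`. -/
def cls (φ : X ≃ₜ X) : C(X, ℤ) →+ G φ := QuotientAddGroup.mk' (infinitesimals φ)

theorem cls_eq_zero_iff (φ : X ≃ₜ X) (f : C(X, ℤ)) :
    cls φ f = 0 ↔ f ∈ infinitesimals φ :=
  QuotientAddGroup.eq_zero_iff f

/-- The positive cone `G_φ⁺ = {[f] | f ≥ 0}` of `G_φ`. -/
def positiveCone (φ : X ≃ₜ X) : AddGroupCone (G φ) where
  carrier := {a | ∃ f : C(X, ℤ), 0 ≤ f ∧ cls φ f = a}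
  zero_mem' := ⟨0, le_rfl, map_zero _⟩
  add_mem' := by
    rintro _ _ ⟨f, hf, rfl⟩ ⟨g, hg, rfl⟩
    exact ⟨f + g, fun x => add_nonneg (hf x) (hg x), map_add _ _ _⟩
  eq_zero_of_mem_of_neg_mem' := by
    rintro _ ⟨f, hf, rfl⟩ ⟨g, hg, hgf⟩
    have hz : f + g ∈ infinitesimals φ := by
      rw [← cls_eq_zero_iff, map_add, hgf, add_neg_cancel]
    rw [cls_eq_zero_iff]
    intro μ hμ
    have h := integral_add (integrable_intCast f μ) (integrable_intCast g μ)
    have h0 := hz μ hμ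
    have hf0 : 0 ≤ ∫ x, (f x : ℝ) ∂(μ : Measure X) :=
      integral_nonneg fun x => Int.cast_nonneg (hf x)
    have hg0 : 0 ≤ ∫ x, (g x : ℝ) ∂(μ : Measure X) :=
      integral_nonneg fun x => Int.cast_nonneg (hg x)
    simp only [ContinuousMap.add_apply, Int.cast_add] at h0
    linarith

/-- The order of `(G_φ, G_φ⁺)`: `a ≤ b` if and only if `b - a ∈ G_φ⁺`. -/
instance (φ : X ≃ₜ X) : PartialOrder (G φ) := PartialOrder.mkOfAddGroupCone (positiveCone φ)

instance (φ : X ≃ₜ X) : IsOrderedAddMonoid (G φ) := IsOrderedAddMonoid.mkOfCone (positiveCone φ)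

theorem le_iff_sub_mem (φ : X ≃ₜ X) (a b : G φ) : a ≤ b ↔ b - a ∈ positiveCone φ := Iff.rfl

end ClopenDynamics

/-!
Two facts carry the proof. Throughout, `φ` has at least one invariant probability measure,
by the Krylov–Bogoliubov argument (`exists_mem_invariantMeasures_integral_nonpos`).

* If `φ` has two invariant probability measures `μ ≠ ν`, the normalised positive and negative
  parts of `μ - ν` are invariant and mutually singular, since `φ` preserves the Jordan
  decomposition. By regularity and total disconnectedness, a clopen set `A` exists which is more
  than half of the space for one of them and less than half for the other
  (`exists_isClopen_opposite_measure_compl`). Then `A` and `Aᶜ` are not comparable, and neither are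
  the classes of their indicators in `G φ`.

* If `f : C(X, ℤ)` has positive integral against every invariant measure, some Birkhoff sum of `f`
  is everywhere nonnegative, for otherwise a weak limit of empirical measures would be an invariant
  measure with nonpositive integral. In that case `f` is cohomologous to a nonnegative function
  (`cls_mem_positiveCone_of_birkhoffSum_nonneg`): with `m` the minimum of the Birkhoff sums of
  lengths `0, …, n - 1`, the function `f + m ∘ φ - m` is nonnegative. Under unique ergodicity every
  `f` has positive, zero or negative integral, so its class is comparable with `0`.
-/

namespace ClopenDynamics

open Filter Topology Set

variable {X : Type*} [MetricSpace X] [CompactSpace X] [MeasurableSpace X] [BorelSpace X]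

/-! ### Empirical measures and their limits -/

/-- The uniform probability measure on the orbit segment `x, φ x, …, φⁿ x`, which has `n + 1`
points counted with multiplicity. -/
noncomputable def empiricalMeasure (φ : X ≃ₜ X) (n : ℕ) (x : X) : ProbabilityMeasure X :=
  ⟨((n + 1 : ℕ) : ENNReal)⁻¹ • ∑ k ∈ Finset.range (n + 1), Measure.dirac (φ^[k] x), ⟨by
    simp only [Measure.smul_apply, Measure.coe_finsetSum, Finset.sum_apply, measure_univ,
      Finset.sum_const, Finset.card_range, nsmul_eq_mul, mul_one, smul_eq_mul]
    exact ENNReal.inv_mul_cancel (by simp) (ENNReal.natCast_ne_top _)⟩⟩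

theorem integral_empiricalMeasure (φ : X ≃ₜ X) (n : ℕ) (x : X) (g : C(X, ℝ)) :
    ∫ y, g y ∂(empiricalMeasure φ n x : Measure X) = birkhoffAverage ℝ φ g (n + 1) x := by
  change ∫ y, g y ∂(((n + 1 : ℕ) : ENNReal)⁻¹ •
    ∑ k ∈ Finset.range (n + 1), Measure.dirac (φ^[k] x)) = _
  rw [integral_smul_measure, integral_finsetSum_measure]
  · simp [birkhoffAverage, birkhoffSum, -Nat.cast_add]
  · intro k _
    exact g.continuous.integrable_of_hasCompactSupport (HasCompactSupport.of_compactSpace _)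

/-- A Krylov–Bogoliubov theorem: if `f` has a nonpositive Birkhoff sum of every positive length,
then some invariant measure gives `f` a nonpositive integral. -/
theorem exists_mem_invariantMeasures_integral_nonpos (φ : X ≃ₜ X) (f : C(X, ℝ)) (x : ℕ → X)
    (hx : ∀ n, birkhoffSum φ f (n + 1) (x n) ≤ 0) :
    ∃ μ ∈ invariantMeasures φ, ∫ y, f y ∂(μ : Measure X) ≤ 0 := by
  let e : ℕ → ProbabilityMeasure X := fun n => empiricalMeasure φ n (x n)
  obtain ⟨μ, -, hμ⟩ := isCompact_univ.ultrafilter_le_nhds ((hyperfilter ℕ).map e) (by simp)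
  have hlim (g : C(X, ℝ)) : Tendsto (fun n => birkhoffAverage ℝ φ g (n + 1) (x n))
      (hyperfilter ℕ) (𝓝 (∫ y, g y ∂(μ : Measure X))) := by
    have h : Tendsto e (hyperfilter ℕ) (𝓝 μ) := hμ
    rw [ProbabilityMeasure.tendsto_iff_forall_integral_tendsto] at h
    refine (h (BoundedContinuousFunction.mkOfCompact g)).congr fun n => ?_
    exact integral_empiricalMeasure φ n (x n) g
  refine ⟨μ, ⟨φ.continuous.measurable, ?_⟩, ?_⟩
  · have := Measure.isProbabilityMeasure_map (μ := (μ : Measure X))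
      φ.continuous.measurable.aemeasurable
    refine ext_of_forall_integral_eq_of_IsFiniteMeasure fun g => ?_
    rw [integral_map φ.continuous.measurable.aemeasurable g.continuous.aestronglyMeasurable]
    -- The averages of `g ∘ φ` and `g` along a segment of length `n + 1` differ by `O(1 / n)`.
    have hdiff := (hlim (g.toContinuousMap.comp (φ : C(X, X)))).sub (hlim g.toContinuousMap)
    have hzero : Tendsto (fun n : ℕ => 2 * ‖g‖ * (1 / ((n : ℝ) + 1))) (hyperfilter ℕ) (𝓝 0) := by
      have h := (tendsto_one_div_add_atTop_nhds_zero_nat (𝕜 := ℝ)).const_mul (2 * ‖g‖)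
      rw [mul_zero] at h
      exact h.mono_left Nat.hyperfilter_le_atTop
    refine sub_eq_zero.mp (tendsto_nhds_unique hdiff (squeeze_zero_norm (fun n => ?_) hzero))
    have hshift : birkhoffAverage ℝ φ (g.toContinuousMap.comp (φ : C(X, X))) (n + 1) (x n) =
        birkhoffAverage ℝ φ g (n + 1) (φ (x n)) := by
      simp [birkhoffAverage, birkhoffSum, ← Function.iterate_succ_apply,
        Function.iterate_succ_apply']
    have h := birkhoffAverage_apply_sub_birkhoffAverage (R := ℝ) φ g (n + 1) (x n)
    rw [hshift]
    refine (congrArg norm h).le.trans ?_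
    rw [norm_smul, mul_comm]
    have h2 : ‖g (φ^[n + 1] (x n)) - g (x n)‖ ≤ 2 * ‖g‖ := by
      have h3 := norm_sub_le (g (φ^[n + 1] (x n))) (g (x n))
      linarith [g.norm_coe_le_norm (φ^[n + 1] (x n)), g.norm_coe_le_norm (x n)]
    refine mul_le_mul h2 (le_of_eq ?_) (norm_nonneg _) (by positivity)
    rw [norm_inv, Real.norm_natCast, one_div, Nat.cast_succ]
  · refine le_of_tendsto' (hlim f) fun n => ?_
    rw [birkhoffAverage, smul_eq_mul]
    exact mul_nonpos_of_nonneg_of_nonpos (by positivity) (hx n)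

theorem invariantMeasures_nonempty [Nonempty X] (φ : X ≃ₜ X) : (invariantMeasures φ).Nonempty := by
  obtain ⟨μ, hμ, -⟩ := exists_mem_invariantMeasures_integral_nonpos φ 0
    (fun _ => Classical.arbitrary X) (by simp [birkhoffSum])
  exact ⟨μ, hμ⟩

theorem exists_birkhoffSum_nonneg (φ : X ≃ₜ X) (f : C(X, ℤ))
    (hf : ∀ μ ∈ invariantMeasures φ, 0 < ∫ x, (f x : ℝ) ∂(μ : Measure X)) :
    ∃ n, ∀ x, 0 ≤ birkhoffSum φ f (n + 1) x := by
  by_contra! h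
  choose x hx using h
  let f' : C(X, ℝ) := ⟨fun y => (f y : ℝ),
    (continuous_of_discreteTopology (f := fun n : ℤ => (n : ℝ))).comp f.continuous⟩
  obtain ⟨μ, hμ, hle⟩ := exists_mem_invariantMeasures_integral_nonpos φ f' x fun n => by
    have h : birkhoffSum φ f' (n + 1) (x n) = ((birkhoffSum φ f (n + 1) (x n) : ℤ) : ℝ) := by
      simp [birkhoffSum, f']
    rw [h]
    exact_mod_cast (hx n).le
  exact (hf μ hμ).not_ge hle

/-! ### Coboundaries and the positive cone -/

theorem comp_sub_mem_infinitesimals (φ : X ≃ₜ X) (m : C(X, ℤ)) :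
    m.comp (φ : C(X, X)) - m ∈ infinitesimals φ := by
  intro μ hμ
  have hint := integral_sub (integrable_intCast (m.comp (φ : C(X, X))) μ) (integrable_intCast m μ)
  have hcomp : ∫ x, (m (φ x) : ℝ) ∂(μ : Measure X) = ∫ x, (m x : ℝ) ∂(μ : Measure X) :=
    MeasurePreserving.integral_comp hμ φ.measurableEmbedding (fun x => (m x : ℝ))
  simp only [ContinuousMap.comp_apply, ContinuousMap.coe_coe, hcomp, sub_self] at hint
  simpa using hint

/-- A function with an everywhere nonnegative Birkhoff sum is cohomologous to a nonnegative
function. -/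
theorem cls_mem_positiveCone_of_birkhoffSum_nonneg (φ : X ≃ₜ X) (f : C(X, ℤ)) (n : ℕ)
    (hf : ∀ x, 0 ≤ birkhoffSum φ f (n + 1) x) : cls φ f ∈ positiveCone φ := by
  let S : ℕ → C(X, ℤ) := fun k => ⟨birkhoffSum φ f k, by
    unfold birkhoffSum
    exact continuous_finsetSum _ fun i _ => f.continuous.comp (φ.continuous.iterate i)⟩
  have hne : (Finset.range (n + 1)).Nonempty := Finset.nonempty_range_add_one
  let m : C(X, ℤ) := (Finset.range (n + 1)).inf' hne S
  have hm (x : X) {k : ℕ} (hk : k < n + 1) : m x ≤ birkhoffSum φ f k x := by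
    simp only [m, ContinuousMap.inf'_apply]
    exact Finset.inf'_le _ (Finset.mem_range.mpr hk)
  refine ⟨f + (m.comp (φ : C(X, X)) - m), fun x => ?_, ?_⟩
  · obtain ⟨k, hk, hkm⟩ := Finset.exists_mem_eq_inf' hne fun k => S k (φ x)
    have hmφ : f x + m (φ x) = birkhoffSum φ f (k + 1) x := by
      rw [birkhoffSum_succ']
      simp only [m, ContinuousMap.inf'_apply, hkm]
      rfl
    have hle : m x ≤ birkhoffSum φ f (k + 1) x := by
      obtain hlt | heq := Nat.lt_or_eq_of_le (Nat.succ_le_of_lt (Finset.mem_range.mp hk))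
      · exact hm x hlt
      · -- The sum of length `n + 1` is not among those minimised, but it is at least the empty sum.
        have h0 := hm x n.succ_pos
        rw [birkhoffSum_zero] at h0
        rw [← Nat.succ_eq_add_one, heq]
        exact h0.trans (hf x)
    change 0 ≤ f x + (m (φ x) - m x)
    linarith
  · rw [map_add, (cls_eq_zero_iff φ _).mpr (comp_sub_mem_infinitesimals φ m), add_zero]

theorem cls_nonneg_of_forall_integral_pos (φ : X ≃ₜ X) (f : C(X, ℤ))
    (hf : ∀ μ ∈ invariantMeasures φ, 0 < ∫ x, (f x : ℝ) ∂(μ : Measure X)) : 0 ≤ cls φ f := by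
  obtain ⟨n, hn⟩ := exists_birkhoffSum_nonneg φ f hf
  rw [le_iff_sub_mem, sub_zero]
  exact cls_mem_positiveCone_of_birkhoffSum_nonneg φ f n hn

theorem integral_nonneg_of_cls_nonneg (φ : X ≃ₜ X) {f : C(X, ℤ)} (hf : 0 ≤ cls φ f)
    {μ : ProbabilityMeasure X} (hμ : μ ∈ invariantMeasures φ) :
    0 ≤ ∫ x, (f x : ℝ) ∂(μ : Measure X) := by
  rw [le_iff_sub_mem, sub_zero] at hf
  obtain ⟨g, hg, hgf⟩ := hf
  have hz : g - f ∈ infinitesimals φ := by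
    rw [← cls_eq_zero_iff, map_sub, hgf, sub_self]
  have h := integral_sub (integrable_intCast g μ) (integrable_intCast f μ)
  have h0 := hz μ hμ
  have hg0 : 0 ≤ ∫ x, (g x : ℝ) ∂(μ : Measure X) :=
    integral_nonneg fun x => Int.cast_nonneg (hg x)
  simp only [ContinuousMap.sub_apply, Int.cast_sub] at h0
  linarith

/-- The indicator function of a clopen set, as an element of `C(X, ℤ)`. -/
noncomputable def clopenIndicator {A : Set X} (hA : IsClopen A) : C(X, ℤ) :=
  LocallyConstant.charFn ℤ hA

omit [CompactSpace X] in
theorem integral_clopenIndicator {A : Set X} (hA : IsClopen A) (μ : ProbabilityMeasure X) :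
    ∫ x, (clopenIndicator hA x : ℝ) ∂(μ : Measure X) = (μ : Measure X).real A := by
  rw [← integral_indicator_one hA.isOpen.measurableSet]
  congr 1 with x
  by_cases hx : x ∈ A <;> simp [clopenIndicator, LocallyConstant.coe_charFn, hx]

theorem measure_le_of_cls_clopenIndicator_le (φ : X ≃ₜ X) {A B : Set X} {hA : IsClopen A}
    {hB : IsClopen B} (h : cls φ (clopenIndicator hA) ≤ cls φ (clopenIndicator hB))
    {μ : ProbabilityMeasure X} (hμ : μ ∈ invariantMeasures φ) :
    (μ : Measure X) A ≤ (μ : Measure X) B := by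
  rw [← sub_nonneg, ← map_sub] at h
  have h0 := integral_nonneg_of_cls_nonneg φ h hμ
  simp only [ContinuousMap.sub_apply, Int.cast_sub] at h0
  rw [integral_sub (integrable_intCast _ μ) (integrable_intCast _ μ), integral_clopenIndicator,
    integral_clopenIndicator, sub_nonneg] at h0
  exact (ENNReal.toReal_le_toReal (measure_ne_top _ _) (measure_ne_top _ _)).mp h0

/-! ### Separating invariant measures by clopen sets -/

omit [CompactSpace X] in
/-- The truncated difference of invariant measures, that is, the positive part of the signed
measure `μ - ν`, is invariant. -/
theorem measurePreserving_sub {φ : X ≃ₜ X} {μ ν : ProbabilityMeasure X}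
    (hμ : μ ∈ invariantMeasures φ) (hν : ν ∈ invariantMeasures φ) :
    MeasurePreserving φ ((μ : Measure X) - ν) ((μ : Measure X) - ν) := by
  have hφ : Measurable φ := φ.continuous.measurable
  refine ⟨hφ, (Measure.eq_of_le_of_measure_univ_eq ?_ ?_).symm⟩
  · -- By minimality of `μ - ν` among the measures `d` with `μ ≤ d + ν`.
    refine Measure.sub_le_of_le_add ?_
    calc (μ : Measure X) = Measure.map φ μ := hμ.map_eq.symm
      _ ≤ Measure.map φ ((μ : Measure X) - ν + ν) :=
        Measure.map_mono (Measure.sub_le_iff_le_add.mp le_rfl) hφ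
      _ = Measure.map φ ((μ : Measure X) - ν) + ν := by rw [Measure.map_add _ _ hφ, hν.map_eq]
  · rw [Measure.map_apply hφ MeasurableSet.univ, preimage_univ]

omit [CompactSpace X] in
theorem exists_mem_invariantMeasures_absolutelyContinuous_sub {φ : X ≃ₜ X}
    {μ ν : ProbabilityMeasure X} (hμ : μ ∈ invariantMeasures φ) (hν : ν ∈ invariantMeasures φ)
    (hne : μ ≠ ν) :
    ∃ ρ ∈ invariantMeasures φ, (ρ : Measure X) ≪ (μ : Measure X) - ν := by
  have h0 : (μ : Measure X) - ν ≠ 0 := by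
    intro h
    have hle := Measure.sub_le_iff_le_add.mp h.le
    rw [zero_add] at hle
    exact hne (ProbabilityMeasure.toMeasure_injective
      (Measure.eq_of_le_of_isProbabilityMeasure hle))
  have : NeZero ((μ : Measure X) - ν) := ⟨h0⟩
  exact ⟨⟨(((μ : Measure X) - ν) univ)⁻¹ • ((μ : Measure X) - ν), inferInstance⟩,
    (measurePreserving_sub hμ hν).smul_measure _, Measure.smul_absolutelyContinuous⟩

omit [MetricSpace X] [CompactSpace X] [BorelSpace X] in
theorem measure_compl_lt_iff {A : Set X} (hA : MeasurableSet A) (μ : ProbabilityMeasure X) :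
    (μ : Measure X) Aᶜ < (μ : Measure X) A ↔ 2⁻¹ < (μ : Measure X) A := by
  have h := probReal_add_probReal_compl (μ := (μ : Measure X)) hA
  rw [← ENNReal.toReal_lt_toReal (measure_ne_top _ _) (measure_ne_top _ _),
    ← ENNReal.toReal_lt_toReal (by simp) (measure_ne_top _ _), ENNReal.toReal_inv,
    ENNReal.toReal_ofNat]
  simp only [Measure.real] at h
  constructor <;> intro <;> linarith

/-- If `φ` has two invariant measures, then a clopen set and its complement are ordered in opposite
ways by two invariant measures. These are not the given ones, but mutually singular ones obtained
from their difference. -/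
theorem exists_isClopen_opposite_measure_compl [TotallyDisconnectedSpace X] {φ : X ≃ₜ X}
    {μ ν : ProbabilityMeasure X} (hμ : μ ∈ invariantMeasures φ) (hν : ν ∈ invariantMeasures φ)
    (hne : μ ≠ ν) :
    ∃ A, IsClopen A ∧
      (∃ ρ ∈ invariantMeasures φ, (ρ : Measure X) Aᶜ < (ρ : Measure X) A) ∧
      ∃ σ ∈ invariantMeasures φ, (σ : Measure X) A < (σ : Measure X) Aᶜ := by
  obtain ⟨ρ, hρ, hρac⟩ := exists_mem_invariantMeasures_absolutelyContinuous_sub hμ hν hne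
  obtain ⟨σ, hσ, hσac⟩ := exists_mem_invariantMeasures_absolutelyContinuous_sub hν hμ hne.symm
  obtain ⟨s, hs⟩ := exists_isHahnDecomposition (μ : Measure X) (ν : Measure X)
  have hρs : (ρ : Measure X) s = 0 := hρac
    (Measure.sub_apply_eq_zero_of_restrict_le_restrict hs.le_on hs.measurableSet)
  have hσs : (σ : Measure X) sᶜ = 0 := hσac
    (Measure.sub_apply_eq_zero_of_restrict_le_restrict hs.ge_on_compl hs.measurableSet.compl)
  have hρs1 : (ρ : Measure X) sᶜ = 1 := (prob_compl_eq_one_iff hs.measurableSet).mpr hρs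
  obtain ⟨K, hKs, hK, hρK⟩ := hs.measurableSet.compl.exists_lt_isCompact (μ := (ρ : Measure X))
    (r := 2⁻¹) (by rw [hρs1]; exact ENNReal.inv_lt_one.mpr ENNReal.one_lt_two)
  obtain ⟨U, hsU, hU, hσU⟩ := sᶜ.exists_isOpen_lt_of_lt (μ := (σ : Measure X)) 2⁻¹
    (by rw [hσs]; simp)
  obtain ⟨A, hA, hKA, hAU⟩ := exists_clopen_of_closed_subset_open hK.isClosed hU (hKs.trans hsU)
  refine ⟨A, hA, ⟨ρ, hρ, ?_⟩, σ, hσ, ?_⟩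
  · exact (measure_compl_lt_iff hA.isOpen.measurableSet ρ).mpr (hρK.trans_le (measure_mono hKA))
  · have h := (measure_mono hAU).trans_lt hσU
    have hc : 2⁻¹ < (σ : Measure X) Aᶜ := by
      have hadd := prob_add_prob_compl (μ := (σ : Measure X)) hA.isOpen.measurableSet
      by_contra! hle
      have hlt := ENNReal.add_lt_add_of_lt_of_le (measure_ne_top _ _) h hle
      rw [hadd, ENNReal.inv_two_add_inv_two] at hlt
      exact lt_irrefl _ hlt
    exact h.trans hc

theorem uniquelyErgodic_of_forall_isClopen [TotallyDisconnectedSpace X] [Nonempty X] (φ : X ≃ₜ X)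
    (h : ∀ A, IsClopen A → (∀ μ ∈ invariantMeasures φ, (μ : Measure X) Aᶜ ≤ (μ : Measure X) A) ∨
      ∀ μ ∈ invariantMeasures φ, (μ : Measure X) A ≤ (μ : Measure X) Aᶜ) :
    UniquelyErgodic φ := by
  obtain ⟨μ, hμ⟩ := invariantMeasures_nonempty φ
  refine ⟨μ, hμ, fun ν hν => ?_⟩
  by_contra hne
  obtain ⟨A, hA, ⟨ρ, hρ, hρA⟩, σ, hσ, hσA⟩ := exists_isClopen_opposite_measure_compl hν hμ hne
  obtain h | h := h A hA
  · exact (h σ hσ).not_gt hσA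
  · exact (h ρ hρ).not_gt hρA

omit [CompactSpace X] [BorelSpace X] in
theorem Dominates.measure_le {φ : X ≃ₜ X} {A B : Set X} (h : Dominates φ A B)
    {μ : ProbabilityMeasure X} (hμ : μ ∈ invariantMeasures φ) :
    (μ : Measure X) B ≤ (μ : Measure X) A :=
  h.elim (fun h => (h μ hμ).le) fun h => (h μ hμ).ge

/-! ### Consequences of unique ergodicity -/

omit [CompactSpace X] [BorelSpace X] in
theorem UniquelyErgodic.comparable {φ : X ≃ₜ X} (h : UniquelyErgodic φ) (A B : Set X) :
    Comparable φ A B := by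
  obtain ⟨μ, -, huniq⟩ := h
  obtain hlt | heq | hgt := lt_trichotomy ((μ : Measure X) A) ((μ : Measure X) B)
  · exact .inr (.inl fun ν hν => huniq ν hν ▸ hlt)
  · exact .inl (.inr fun ν hν => huniq ν hν ▸ heq)
  · exact .inl (.inl fun ν hν => huniq ν hν ▸ hgt)

theorem UniquelyErgodic.cls_nonneg_or_nonpos {φ : X ≃ₜ X} (h : UniquelyErgodic φ) (f : C(X, ℤ)) :
    0 ≤ cls φ f ∨ cls φ f ≤ 0 := by
  obtain ⟨μ, -, huniq⟩ := h
  obtain hlt | heq | hgt := lt_trichotomy (∫ x, (f x : ℝ) ∂(μ : Measure X)) 0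
  · right
    rw [← neg_nonneg, ← map_neg]
    refine cls_nonneg_of_forall_integral_pos φ (-f) fun ν hν => ?_
    rw [huniq ν hν]
    simpa [integral_neg] using hlt
  · left
    refine ((cls_eq_zero_iff φ f).mpr fun ν hν => ?_).ge
    rw [huniq ν hν, heq]
  · exact .inl (cls_nonneg_of_forall_integral_pos φ f fun ν hν => huniq ν hν ▸ hgt)

theorem UniquelyErgodic.le_total {φ : X ≃ₜ X} (h : UniquelyErgodic φ) (a b : G φ) :
    a ≤ b ∨ b ≤ a := by
  obtain ⟨f, hf⟩ : ∃ f, cls φ f = b - a := QuotientAddGroup.mk'_surjective _ (b - a)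
  obtain hf' | hf' := h.cls_nonneg_or_nonpos f
  · exact .inl (sub_nonneg.mp (hf'.trans_eq hf))
  · exact .inr (sub_nonpos.mp (hf.symm.trans_le hf'))

end ClopenDynamics

theorem theorem1 {X : Type*} [MetricSpace X] [CompactSpace X] [TotallyDisconnectedSpace X]
    [Nonempty X] [MeasurableSpace X] [BorelSpace X] (φ : X ≃ₜ X) :
    List.TFAE [
      ClopenDynamics.UniquelyErgodic φ,
      ∀ A B : Set X, IsClopen A → IsClopen B → ClopenDynamics.Comparable φ A B,
      ∀ a b : ClopenDynamics.G φ, a ≤ b ∨ b ≤ a] := by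
  tfae_have 1 → 2 := fun h A B _ _ => h.comparable A B
  tfae_have 1 → 3 := fun h => h.le_total
  tfae_have 2 → 1 := fun h => ClopenDynamics.uniquelyErgodic_of_forall_isClopen φ fun A hA =>
    (h A Aᶜ hA hA.compl).imp (fun h _ hμ => h.measure_le hμ) fun h _ hμ => h.measure_le hμ
  tfae_have 3 → 1 := fun h => ClopenDynamics.uniquelyErgodic_of_forall_isClopen φ fun A hA =>
    (h (ClopenDynamics.cls φ (ClopenDynamics.clopenIndicator hA.compl))
      (ClopenDynamics.cls φ (ClopenDynamics.clopenIndicator hA))).imp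
      (fun h _ hμ => ClopenDynamics.measure_le_of_cls_clopenIndicator_le φ h hμ)
      fun h _ hμ => ClopenDynamics.measure_le_of_cls_clopenIndicator_le φ h hμ
  tfae_finish
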